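/- Let $n\ge 1$ and let $\omega=a(x,y)\,dx+b(x,y)\,dy$ be a nonzero singular formal $1$-form, where $a=\sum a_{ij}x^iy^j$ and $b=\sum b_{ij}x^iy^j$ are power series in $y$ with coefficients in $\mathbb{C}[[x^{1/n}]]$ (so $i\in\frac1n\mathbb{Z}_{\ge0}$, $j\in\mathbb{Z}_{\ge0}$) and $a(0,0)=b(0,0)=0$. Let $\mathcal{C}(\omega)$ be the set of points $(i,j)$ with $a_{i,j}\ne0$ or $b_{i+1,j-1}\ne0$, let the Newton polygon $\mathcal{N}(\omega)$ be the convex hull of $\mathcal{C}(\omega)+\mathbb{R}_{\ge0}^2$, and let $L_1$ be the line of slope $-1$ that meets $\mathcal{N}(\omega)$ only at its topological border. The $y$-order of $\omega$ is the ordinate of the highest point of $\mathcal{N}(\omega)\cap L_1$ (it exists and is unique). The multiplicity of $\omega$ is $\min(\operatorname{ord}a,\operatorname{ord}b)+1$, where $x^iy^j$ has degree $i+j$ and $\operatorname{ord}0=\infty$. Let $m\ge1$ and let $\Gamma:\ y=s(x)=\sum_{k\ge m}f_kx^{k/m}$ be a formal branch transverse to $x=0$ that is invariant for $\omega$, that is,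 $a(x,s(x))+b(x,s(x))\,s'(x)=0$, where $s'(x)=\sum_{k\ge m}\frac km f_kx^{k/m-1}$. A Puiseux exponent of $\Gamma$ over $\mathbb{C}((x^{1/n}))$ is an exponent $k/m$ with $f_k\ne0$ that does not belong to the subgroup of $\mathbb{Q}$ generated by $\frac1n$ and all $l/m$ with $l<k$, $f_l\neq0$; for $n=1$, i.e. for $\omega$ with coefficients in $\mathbb{C}[[x,y]]$, these are the usual Puiseux exponents of $\Gamma$. Then the number $r$ of these Puiseux exponents of $\Gamma$ is finite, and the $y$-order of $\omega$ is at least $r$. Consequently the multiplicity of $\omega$ is an upper bound for the number of Puiseux exponents of every invariant branch transverse to $x=0$. No assumption is made on whether $\omega$ is dicritical. -/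

import Mathlib

open scoped ENNReal

noncomputable section

/-- A formal 1-form `ω = a dx + b dy` whose coefficients `a, b` are power series in `y` with
coefficients in `ℂ⟦x^{1/n}⟧`.  An element of that ring is stored as a power series in the two
variables `x^{1/n}` (index `0`) and `y` (index `1`). -/
structure FormalOneForm (n : ℕ) where
  /-- the coefficient of `dx` -/
  a : MvPowerSeries (Fin 2) ℂ
  /-- the coefficient of `dy` -/
  b : MvPowerSeries (Fin 2) ℂ

/-- The coefficient of `x^{i/n} y^j`. -/
def xyCoeff (i j : ℕ) (g : MvPowerSeries (Fin 2) ℂ) : ℂ :=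
  MvPowerSeries.coeff (Finsupp.single 0 i + Finsupp.single 1 j) g

/-- The order of a series in `x^{1/n}` and `y`, where `x^{i/n} y^j` has degree `i/n + j`;
the zero series has order `∞`. -/
def xyOrder (n : ℕ) (g : MvPowerSeries (Fin 2) ℂ) : ℝ≥0∞ :=
  ⨅ (i : ℕ) (j : ℕ) (_ : xyCoeff i j g ≠ 0), ((i : ℝ≥0∞) / (n : ℝ≥0∞) + (j : ℝ≥0∞))

/-- The value `g(x, s(x))`, where `g` is a series in `x^{1/n}` and `y`, and `s = ∑ f_k x^{k/m}`.
Everything is written in the variable `u = x^{1/(nm)}`, so that `x^{1/n} = u^m` and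
`x^{1/m} = u^n`. -/
def evalOnBranch (n m : ℕ) (f : PowerSeries ℂ) (g : MvPowerSeries (Fin 2) ℂ) : PowerSeries ℂ :=
  MvPowerSeries.subst
    ![(PowerSeries.X ^ m : PowerSeries ℂ), f.subst (PowerSeries.X ^ n : PowerSeries ℂ)] g

/-- `∑ f_k x^{k/m}` only involves exponents `k/m ≥ 1`: the Puiseux expansion of a formal branch
transverse to `x = 0`. -/
def IsTransverse (m : ℕ) (f : PowerSeries ℂ) : Prop :=
  ∀ k < m, PowerSeries.coeff k f = 0

/-- The derivative `∑ (k/m) f_k x^{k/m - 1}` of a transverse branch `∑ f_k x^{k/m}`, as a power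
series in `x^{1/m}`. -/
def branchDeriv (m : ℕ) (f : PowerSeries ℂ) : PowerSeries ℂ :=
  PowerSeries.mk fun l => (((l + m : ℕ) : ℂ) / (m : ℂ)) * PowerSeries.coeff (l + m) f

/-- The Puiseux exponents of `∑ f_k x^{k/m}` over `ℂ((x^{1/n}))`: the exponents `μ = k/m` with
`f_k ≠ 0` that do not belong to the subgroup of `ℚ` generated by `1/n` and the smaller exponents
occurring in the series, i.e. the exponents at which the common denominator (starting from `n`)
increases.  For `n = 1` these are the usual Puiseux (characteristic) exponents. -/
def puiseuxExponents (n m : ℕ) (f : PowerSeries ℂ) : Set ℚ :=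
  {μ | ∃ k : ℕ, μ = (k : ℚ) / (m : ℚ) ∧ PowerSeries.coeff k f ≠ 0 ∧
    μ ∉ AddSubgroup.closure
      (insert (1 / (n : ℚ)) {ν | ∃ l < k, PowerSeries.coeff l f ≠ 0 ∧ ν = (l : ℚ) / (m : ℚ)})}

/-- The line `{(u, v) : u + μ v = τ}`, of co-slope `μ` (slope `-1/μ`), through `(τ, 0)`. -/
def coslopeLine (μ τ : ℝ) : Set (ℝ × ℝ) :=
  {p | p.1 + μ * p.2 = τ}

namespace FormalOneForm

variable {n : ℕ}

/-- `a(0,0) = b(0,0) = 0`. -/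
def IsSingular (ω : FormalOneForm n) : Prop :=
  MvPowerSeries.constantCoeff ω.a = 0 ∧ MvPowerSeries.constantCoeff ω.b = 0

/-- The branch `s = ∑ f_k x^{k/m}` is invariant: `a(x, s(x)) + b(x, s(x)) s'(x) = 0`. -/
def IsInvariant (ω : FormalOneForm n) (m : ℕ) (f : PowerSeries ℂ) : Prop :=
  evalOnBranch n m f ω.a +
    evalOnBranch n m f ω.b * (branchDeriv m f).subst (PowerSeries.X ^ n : PowerSeries ℂ) = 0

/-- The cloud of points: the `(i, j)` such that the coefficient of `x^i y^j` in `a` or the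
coefficient of `x^{i+1} y^{j-1}` in `b` is nonzero. -/
def cloud (ω : FormalOneForm n) : Set (ℝ × ℝ) :=
  {p | ∃ i j : ℕ, (xyCoeff i j ω.a ≠ 0 ∧ p = ((i : ℝ) / (n : ℝ), (j : ℝ))) ∨
    (xyCoeff i j ω.b ≠ 0 ∧ p = ((i : ℝ) / (n : ℝ) - 1, (j : ℝ) + 1))}

/-- The Newton polygon: the convex envelope of the quadrants `p + ℝ≥0 × ℝ≥0`, `p` in the cloud. -/
def newtonPolygon (ω : FormalOneForm n) : Set (ℝ × ℝ) :=
  convexHull ℝ {q | ∃ p ∈ ω.cloud, p.1 ≤ q.1 ∧ p.2 ≤ q.2}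

/-- A line meets the Newton polygon, and only at its topological border. -/
def IsSupportingLine (ω : FormalOneForm n) (L : Set (ℝ × ℝ)) : Prop :=
  (ω.newtonPolygon ∩ L).Nonempty ∧ ω.newtonPolygon ∩ L ⊆ frontier ω.newtonPolygon

/-- `h` is the `y`-order: the ordinate of the highest point of the Newton polygon on the
supporting line of co-slope `1`. -/
def IsYOrder (ω : FormalOneForm n) (h : ℝ) : Prop :=
  ∃ τ : ℝ, ω.IsSupportingLine (coslopeLine 1 τ) ∧
    IsGreatest (Prod.snd '' (ω.newtonPolygon ∩ coslopeLine 1 τ)) h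

/-- The multiplicity: the smallest order of `a, b`, plus one. -/
def multiplicity (ω : FormalOneForm n) : ℝ≥0∞ :=
  min (xyOrder n ω.a) (xyOrder n ω.b) + 1

end FormalOneForm

end

noncomputable section

/-! Put `u = x^{1/(nm)}`, `N = nm` and write the branch as `s = u^N t`. Since `N s' = N t + u t'`,
invariance becomes `A(u,t) + B(u,t) u t' = 0` with `A = N(a + b t)` and `B = b`, both divided by
`u^{mk}`, where `k/n` is the minimal weight of a monomial. Say that such an equation has height `H`
if its reductions `A₀, B₀` modulo `u` satisfy `deg A₀ ≤ H` and `deg B₀ < H`. At the start `H` can be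
taken to be the `y`-order (`exists_tailForm`, `isYOrder_iff`).

The coefficients of the branch are removed one at a time: substitute `y = c + u z` and divide by the
largest power of `u` (`exists_step`). The new height is at most the order of `A₀` at `c`, and at
most one plus the order of `B₀` at `c`, so it never grows. At a Puiseux exponent `e` one has `c ≠
0`, and `e` is outside the group generated so far. The exponents of the equation lie in one coset
(`LatticeSupported`), hence `A₀` and `B₀` have no two consecutive monomials. A polynomial of
positive degree with this property is not a multiple of a power of `X - c` of the same degree
(`exists_coeff_taylor_ne_zero_of_gap`), so the height drops.

The one exception is `H = 1`, `A₀ = 0`, `B₀` a nonzero constant. The height may then stay `1`, but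
the equation becomes linear and no further Puiseux exponent occurs
(`not_mem_jumpExponents_of_linear`). In all cases at most `H` exponents are counted
(`card_jumpExponents_le`), and `H` is at most the multiplicity (`le_multiplicity`). -/

/-! ### Taylor expansion of polynomials with gaps -/

open Polynomial in
theorem coeff_taylor_eq_sum {R : Type*} [CommRing R] (r : R) (p : R[X]) (j n : ℕ)
    (hn : p.natDegree < n + j) :
    (taylor r p).coeff j
      = ∑ i ∈ Finset.range n, ((i + j).choose j : R) * p.coeff (i + j) * r ^ i := by
  have hz : ∀ i, n ≤ i → (hasseDeriv j p).coeff i = 0 := by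
    intro i hi
    rw [hasseDeriv_coeff, coeff_eq_zero_of_natDegree_lt (by omega), mul_zero]
  rw [taylor_coeff]
  rcases Nat.eq_zero_or_pos n with rfl | hpos
  · have : hasseDeriv j p = 0 := by
      ext i
      simpa using hz i (Nat.zero_le i)
    simp [this]
  · have hlt : (hasseDeriv j p).natDegree < n := by
      by_contra! h
      have h1 := hz _ h
      have h2 : hasseDeriv j p = 0 := leadingCoeff_eq_zero.mp h1
      rw [h2, natDegree_zero] at h
      omega
    rw [eval_eq_sum_range' hlt]
    simp only [hasseDeriv_coeff]

open Polynomial in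
/-- A polynomial of degree at most `d + 1` without two consecutive monomials is not a multiple of
`(X - c) ^ (d + 1)`, for `c ≠ 0`. -/
theorem exists_coeff_taylor_ne_zero_of_gap {p : ℂ[X]} {c : ℂ} {d : ℕ} (hp : p ≠ 0) (hc : c ≠ 0)
    (hdeg : p.natDegree ≤ d + 1) (hgap : ¬ (p.coeff d ≠ 0 ∧ p.coeff (d + 1) ≠ 0)) :
    ∃ l ≤ d, (taylor c p).coeff l ≠ 0 := by
  by_cases htop : p.coeff (d + 1) = 0
  · refine ⟨(taylor c p).natDegree, ?_, ?_⟩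
    · rw [natDegree_taylor]
      by_contra! h
      have : p.natDegree = d + 1 := by omega
      rw [← this] at htop
      exact hp (leadingCoeff_eq_zero.mp htop)
    · intro h
      exact hp ((taylor_eq_zero c p).mp (leadingCoeff_eq_zero.mp h))
  · have hd : p.coeff d = 0 := by
      by_contra h
      exact hgap ⟨h, htop⟩
    -- Without a monomial of degree `d`, this Taylor coefficient is `(d + 1) c` times the top
    -- coefficient, nonzero in characteristic zero.
    refine ⟨d, le_rfl, ?_⟩
    rw [coeff_taylor_eq_sum c p d 2 (by omega)]
    simp only [Finset.sum_range_succ, Finset.sum_range_zero, zero_add, hd, add_comm 1 d]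
    have : ((d + 1).choose d : ℂ) ≠ 0 := by
      rw [Nat.choose_succ_self_right]
      exact_mod_cast Nat.succ_ne_zero d
    simp [htop, hc]
    exact_mod_cast Nat.succ_ne_zero d

/-! ### Exponent groups, tails of a series and the blow-up -/

/-- The subgroup of `ℤ` generated by `d` and the exponents smaller than `e` of a power series. -/
def exponentGroup (d : ℕ) (S : PowerSeries ℂ) (e : ℕ) : AddSubgroup ℤ :=
  AddSubgroup.closure (insert (d : ℤ) {z | ∃ l < e, PowerSeries.coeff l S ≠ 0 ∧ z = (l : ℤ)})

theorem exponentGroup_le_succ (d : ℕ) (S : PowerSeries ℂ) (e : ℕ) :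
    exponentGroup d S e ≤ exponentGroup d S (e + 1) := by
  apply AddSubgroup.closure_mono
  apply Set.insert_subset_insert
  rintro z ⟨l, hl, h⟩
  exact ⟨l, by omega, h⟩

theorem mem_exponentGroup_succ (d : ℕ) {S : PowerSeries ℂ} {e : ℕ}
    (h : PowerSeries.coeff e S ≠ 0) : (e : ℤ) ∈ exponentGroup d S (e + 1) :=
  AddSubgroup.subset_closure (Or.inr ⟨e, Nat.lt_succ_self e, h, rfl⟩)

/-- The exponents of `S` outside the group generated by `d` and the smaller exponents. -/
def jumpExponents (d : ℕ) (S : PowerSeries ℂ) : Set ℕ :=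
  {k | PowerSeries.coeff k S ≠ 0 ∧ (k : ℤ) ∉ exponentGroup d S k}

/-- The series `t` with `S = (terms of degree < e) + X ^ e * t`. -/
def tailSeries (S : PowerSeries ℂ) (e : ℕ) : PowerSeries ℂ :=
  PowerSeries.mk fun k => PowerSeries.coeff (k + e) S

theorem tailSeries_eq (S : PowerSeries ℂ) (e : ℕ) :
    tailSeries S e
      = PowerSeries.C (PowerSeries.coeff e S) + PowerSeries.X * tailSeries S (e + 1) := by
  ext k
  cases k with
  | zero => simp [tailSeries]
  | succ k =>
    rw [mul_comm, map_add, PowerSeries.coeff_succ_mul_X]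
    simp [tailSeries, add_assoc, add_comm 1 e]

/-- The derivation `u d/du` of `ℂ⟦u⟧`. -/
def eulerDeriv (s : PowerSeries ℂ) : PowerSeries ℂ :=
  PowerSeries.X * PowerSeries.derivative ℂ s

theorem coeff_eulerDeriv (s : PowerSeries ℂ) (k : ℕ) :
    PowerSeries.coeff k (eulerDeriv s) = k * PowerSeries.coeff k s := by
  cases k with
  | zero => simp [eulerDeriv]
  | succ k =>
    rw [eulerDeriv, mul_comm, PowerSeries.coeff_succ_mul_X, PowerSeries.coeff_derivative]
    push_cast
    ring

theorem eulerDeriv_C_add_X_mul (c : ℂ) (s : PowerSeries ℂ) :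
    eulerDeriv (PowerSeries.C c + PowerSeries.X * s) = PowerSeries.X * (s + eulerDeriv s) := by
  ext k
  rw [coeff_eulerDeriv]
  cases k with
  | zero => simp
  | succ k =>
    rw [mul_comm PowerSeries.X, mul_comm PowerSeries.X, map_add, PowerSeries.coeff_succ_mul_X,
      PowerSeries.coeff_succ_mul_X, map_add, coeff_eulerDeriv]
    simp
    ring

open Polynomial

/-- The substitution `y ↦ c + u y`. -/
def blowUp (c : ℂ) (A : (PowerSeries ℂ)[X]) : (PowerSeries ℂ)[X] :=
  (taylor (PowerSeries.C c) A).comp (C PowerSeries.X * X)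

theorem eval_blowUp (c : ℂ) (A : (PowerSeries ℂ)[X]) (s : PowerSeries ℂ) :
    (blowUp c A).eval s = A.eval (PowerSeries.C c + PowerSeries.X * s) := by
  rw [blowUp, eval_comp, taylor_eval, add_comm]
  simp

theorem coeff_blowUp (c : ℂ) (A : (PowerSeries ℂ)[X]) (j : ℕ) :
    (blowUp c A).coeff j = (taylor (PowerSeries.C c) A).coeff j * PowerSeries.X ^ j :=
  comp_C_mul_X_coeff

/-- Reduction modulo `u` of the coefficients. -/
def residue (A : (PowerSeries ℂ)[X]) : ℂ[X] := A.map PowerSeries.constantCoeff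

theorem coeff_residue (A : (PowerSeries ℂ)[X]) (j : ℕ) :
    (residue A).coeff j = PowerSeries.constantCoeff (A.coeff j) := coeff_map _ _

theorem constantCoeff_coeff_taylor (c : ℂ) (A : (PowerSeries ℂ)[X]) (j : ℕ) :
    PowerSeries.constantCoeff ((taylor (PowerSeries.C c) A).coeff j)
      = (taylor c (residue A)).coeff j := by
  rw [← coeff_residue, residue, map_taylor, residue, PowerSeries.constantCoeff_C]

theorem exists_coeff_ne_zero_of_taylor {c : ℂ} {A : (PowerSeries ℂ)[X]} {j k : ℕ}
    (h : PowerSeries.coeff k ((taylor (PowerSeries.C c) A).coeff j) ≠ 0) :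
    ∃ i, PowerSeries.coeff k (A.coeff (i + j)) ≠ 0 ∧ (c ≠ 0 ∨ i = 0) := by
  rw [coeff_taylor_eq_sum _ A j (A.natDegree + 1) (by omega), map_sum] at h
  obtain ⟨i, -, hi⟩ := Finset.exists_ne_zero_of_sum_ne_zero h
  refine ⟨i, ?_, ?_⟩
  · intro h0
    apply hi
    rw [← map_pow, PowerSeries.coeff_mul_C, ← map_natCast (PowerSeries.C (R := ℂ)),
      PowerSeries.coeff_C_mul, h0]
    simp
  · by_contra! hc
    apply hi
    rw [hc.1, map_zero, zero_pow hc.2]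
    simp

/-- The exponents `(k, j)` of the form with coefficients `A, B`, where a monomial `u^k y^j` of `B`
contributes `(k, j + 1)`, all have `k - e j` in one coset of `G`. -/
def LatticeSupported (G : AddSubgroup ℤ) (e : ℕ) (g : ℤ) (A B : (PowerSeries ℂ)[X]) : Prop :=
  (∀ j k : ℕ, PowerSeries.coeff k (A.coeff j) ≠ 0 → (k : ℤ) - e * j - g ∈ G) ∧
    ∀ j k : ℕ, PowerSeries.coeff k (B.coeff j) ≠ 0 → (k : ℤ) - e * (j + 1) - g ∈ G

/-- With `Y = (known terms) + u^e y`, the number `k - e j` is the exponent of `u` beside `Y^j`.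
Recentring at `c` sends `u^k y^{i+j}` to a multiple of `c^i u^{k+j} z^j`, which shifts this number
by `e i`. The shift lies in the enlarged group if `c ≠ 0`, and only `i = 0` occurs if `c = 0`. -/
theorem lattice_blowUp {G G' : AddSubgroup ℤ} {e : ℕ} {g : ℤ} {c : ℂ} {A : (PowerSeries ℂ)[X]}
    (hG : G ≤ G') (hc : c ≠ 0 → (e : ℤ) ∈ G')
    (hA : ∀ j k : ℕ, PowerSeries.coeff k (A.coeff j) ≠ 0 → (k : ℤ) - e * j - g ∈ G) (j k : ℕ)
    (h : PowerSeries.coeff k ((blowUp c A).coeff j) ≠ 0) :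
    (k : ℤ) - (e + 1 : ℕ) * j - g ∈ G' := by
  rw [coeff_blowUp, PowerSeries.coeff_mul_X_pow'] at h
  split_ifs at h with hjk
  · obtain ⟨i, hi, hci⟩ := exists_coeff_ne_zero_of_taylor h
    have h1 := hG (hA _ _ hi)
    have h2 : (e : ℤ) * i ∈ G' := by
      rcases hci with h0 | rfl
      · have := G'.zsmul_mem (hc h0) i
        rwa [smul_eq_mul, mul_comm] at this
      · simp [G'.zero_mem]
    have h3 := G'.add_mem h1 h2
    convert h3 using 1
    push_cast [Nat.cast_sub hjk]
    ring
  · exact absurd rfl h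

/-! ### Reduced equations satisfied by the tails of a branch -/

/-- The pair `A, B` stands for the equation `A(u, y) + B(u, y) u y' = 0`, reduced (not divisible by
`u`), satisfied modulo `u ^ K` by the tail of `S` of order `e`, and with exponents in the lattice
defined by `S`. -/
structure TailForm (d : ℕ) (S : PowerSeries ℂ) (e K : ℕ) (A B : (PowerSeries ℂ)[X]) : Prop where
  reduced : residue A ≠ 0 ∨ residue B ≠ 0
  invariant : PowerSeries.X ^ K ∣
    A.eval (tailSeries S e) + B.eval (tailSeries S e) * eulerDeriv (tailSeries S e)
  lattice : ∃ g, LatticeSupported (exponentGroup d S e) e g A B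

namespace TailForm

variable {d : ℕ} {S : PowerSeries ℂ} {e K : ℕ} {A B : (PowerSeries ℂ)[X]}

theorem eval_residue (h : TailForm d S e K A B) (hK : 0 < K) :
    (residue A).eval (PowerSeries.coeff e S) = 0 := by
  have h1 := (PowerSeries.X_pow_dvd_iff.mp h.invariant) 0 hK
  have h2 : PowerSeries.constantCoeff (tailSeries S e) = PowerSeries.coeff e S := by
    simp [tailSeries]
  have h3 : PowerSeries.constantCoeff (eulerDeriv (tailSeries S e)) = 0 := by simp [eulerDeriv]
  rw [PowerSeries.coeff_zero_eq_constantCoeff_apply, map_add, map_mul, h3, mul_zero, add_zero,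
    ← eval₂_id, hom_eval₂, h2] at h1
  rw [residue, eval_map]
  simpa using h1

/-- Two consecutive monomials free of `u` have lattice values differing by exactly `e`. Used in
contrapositive form: at a jump exponent both reductions have gaps. -/
theorem mem_of_coeff_ne_zero (h : TailForm d S e K A B) {j : ℕ}
    (hj : ((residue A).coeff j ≠ 0 ∧ (residue A).coeff (j + 1) ≠ 0) ∨
      ((residue B).coeff j ≠ 0 ∧ (residue B).coeff (j + 1) ≠ 0)) :
    (e : ℤ) ∈ exponentGroup d S e := by
  obtain ⟨g, hA, hB⟩ := h.lattice
  simp only [coeff_residue, ← PowerSeries.coeff_zero_eq_constantCoeff_apply] at hj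
  rcases hj with ⟨h1, h2⟩ | ⟨h1, h2⟩
  · have := AddSubgroup.sub_mem _ (hA _ _ h1) (hA _ _ h2)
    convert this using 1
    push_cast
    ring
  · have := AddSubgroup.sub_mem _ (hB _ _ h1) (hB _ _ h2)
    convert this using 1
    push_cast
    ring

/-- Substituting `y = c + u z`, with `c` the constant term of the branch, and dividing by the
largest possible power of `u`. -/
theorem exists_step (h : TailForm d S e K A B) {l : ℕ}
    (hl : (taylor (PowerSeries.coeff e S) (residue A)).coeff l ≠ 0 ∨
      ∃ i, l = i + 1 ∧ (taylor (PowerSeries.coeff e S) (residue B)).coeff i ≠ 0) :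
    ∃ k ≤ l, ∃ A' B', TailForm d S (e + 1) (K - k) A' B' ∧
      (∀ j, k < j → (residue A').coeff j = 0) ∧ (∀ j, k ≤ j → (residue B').coeff j = 0) ∧
      blowUp (PowerSeries.coeff e S) A
          + C PowerSeries.X * X * blowUp (PowerSeries.coeff e S) B = C (PowerSeries.X ^ k) * A' ∧
      C PowerSeries.X * blowUp (PowerSeries.coeff e S) B = C (PowerSeries.X ^ k) * B' := by
  set c := PowerSeries.coeff e S with hc
  set B₁ := C PowerSeries.X * blowUp c B with hB₁
  set A₁ := blowUp c A + C PowerSeries.X * X * blowUp c B with hA₁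
  have hA₁' : A₁ = blowUp c A + B₁ * X := by rw [hA₁, hB₁]; ring
  have hB₁c : ∀ j, B₁.coeff j = (taylor (PowerSeries.C c) B).coeff j * PowerSeries.X ^ (j + 1) := by
    intro j
    rw [hB₁, coeff_C_mul, coeff_blowUp]
    ring
  have hA₁0 : A₁.coeff 0 = (taylor (PowerSeries.C c) A).coeff 0 := by
    rw [hA₁', coeff_add, coeff_blowUp, mul_coeff_zero, coeff_X_zero]
    simp
  have hA₁s : ∀ j, A₁.coeff (j + 1) = ((taylor (PowerSeries.C c) A).coeff (j + 1)
      + (taylor (PowerSeries.C c) B).coeff j) * PowerSeries.X ^ (j + 1) := by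
    intro j
    rw [hA₁', coeff_add, coeff_blowUp, coeff_mul_X, hB₁c]
    ring
  have hA₁d : ∀ j, PowerSeries.X ^ j ∣ A₁.coeff j := by
    intro j
    cases j with
    | zero => simp
    | succ j => exact hA₁s j ▸ dvd_mul_left _ _
  have hBl : ∀ i, (taylor c (residue B)).coeff i ≠ 0 →
      PowerSeries.coeff (i + 1) (B₁.coeff i) ≠ 0 := by
    intro i hi
    rw [hB₁c, PowerSeries.coeff_mul_X_pow']
    simpa [constantCoeff_coeff_taylor] using hi
  have hexl : ∃ j, PowerSeries.coeff l (A₁.coeff j) ≠ 0 ∨ PowerSeries.coeff l (B₁.coeff j) ≠ 0 := by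
    rcases hl with hl | ⟨i, rfl, hi⟩
    · cases l with
      | zero =>
        refine ⟨0, Or.inl ?_⟩
        rw [hA₁0]
        simpa [-taylor_coeff_zero, constantCoeff_coeff_taylor] using hl
      | succ i =>
        -- The contributions of `A` and `B` to `A₁` may cancel, as in the dicritical case; a nonzero
        -- contribution of `B` is then still visible in `B₁`.
        by_cases hi : (taylor c (residue B)).coeff i = 0
        · refine ⟨i + 1, Or.inl ?_⟩
          rw [hA₁s, PowerSeries.coeff_mul_X_pow']
          simpa [constantCoeff_coeff_taylor, hi] using hl
        · exact ⟨i, Or.inr (hBl i hi)⟩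
    · exact ⟨i, Or.inr (hBl i hi)⟩
  classical
  have hex : ∃ k, ∃ j, PowerSeries.coeff k (A₁.coeff j) ≠ 0 ∨
    PowerSeries.coeff k (B₁.coeff j) ≠ 0 := ⟨l, hexl⟩
  obtain ⟨k, ⟨j₀, hj₀⟩, hmin⟩ : ∃ k, (∃ j, PowerSeries.coeff k (A₁.coeff j) ≠ 0 ∨
      PowerSeries.coeff k (B₁.coeff j) ≠ 0) ∧ ∀ i < k, ∀ j, PowerSeries.coeff i (A₁.coeff j) = 0 ∧
      PowerSeries.coeff i (B₁.coeff j) = 0 := by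
    refine ⟨Nat.find hex, Nat.find_spec hex, fun i hi j => ?_⟩
    have := Nat.find_min hex hi
    push Not at this
    exact this j
  have hkl : k ≤ l := by
    by_contra! h
    obtain ⟨j, hj⟩ := hexl
    have := hmin l h j
    tauto
  obtain ⟨A', hA'⟩ : C (PowerSeries.X ^ k) ∣ A₁ := by
    rw [C_dvd_iff_dvd_coeff]
    exact fun j => PowerSeries.X_pow_dvd_iff.mpr fun i hi => (hmin i hi j).1
  obtain ⟨B', hB'⟩ : C (PowerSeries.X ^ k) ∣ B₁ := by
    rw [C_dvd_iff_dvd_coeff]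
    exact fun j => PowerSeries.X_pow_dvd_iff.mpr fun i hi => (hmin i hi j).2
  have hAc : ∀ j i, PowerSeries.coeff i (A'.coeff j) = PowerSeries.coeff (i + k) (A₁.coeff j) := by
    intro j i
    rw [hA', coeff_C_mul, PowerSeries.coeff_X_pow_mul]
  have hBc : ∀ j i, PowerSeries.coeff i (B'.coeff j) = PowerSeries.coeff (i + k) (B₁.coeff j) := by
    intro j i
    rw [hB', coeff_C_mul, PowerSeries.coeff_X_pow_mul]
  have hAr : ∀ j, (residue A').coeff j = PowerSeries.coeff k (A₁.coeff j) := by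
    intro j
    rw [coeff_residue, ← PowerSeries.coeff_zero_eq_constantCoeff_apply, hAc, zero_add]
  have hBr : ∀ j, (residue B').coeff j = PowerSeries.coeff k (B₁.coeff j) := by
    intro j
    rw [coeff_residue, ← PowerSeries.coeff_zero_eq_constantCoeff_apply, hBc, zero_add]
  refine ⟨k, hkl, A', B', ⟨?_, ?_, ?_⟩, ?_, ?_, hA', hB'⟩
  · rcases hj₀ with h0 | h0
    · left
      intro hz
      rw [← hAr, hz, coeff_zero] at h0
      exact h0 rfl
    · right
      intro hz
      rw [← hBr, hz, coeff_zero] at h0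
      exact h0 rfl
  · set t := tailSeries S (e + 1) with ht
    have h1 := h.invariant
    rw [tailSeries_eq S e, ← ht, ← hc, eulerDeriv_C_add_X_mul, ← eval_blowUp, ← eval_blowUp] at h1
    have h2 : (blowUp c A).eval t + (blowUp c B).eval t * (PowerSeries.X * (t + eulerDeriv t))
        = PowerSeries.X ^ k * (A'.eval t + B'.eval t * eulerDeriv t) := by
      have e1 := congrArg (eval t) hA'
      have e2 := congrArg (eval t) hB'
      simp only [hA₁, hB₁, eval_add, eval_mul, eval_C, eval_X] at e1 e2
      linear_combination e1 + eulerDeriv t * e2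
    rw [h2] at h1
    rcases le_total K k with hKk | hKk
    · simp [Nat.sub_eq_zero_of_le hKk]
    · rw [← Nat.add_sub_cancel' hKk, pow_add] at h1
      exact (mul_dvd_mul_iff_left (pow_ne_zero _ PowerSeries.X_ne_zero)).mp h1
  · obtain ⟨g, hA, hB⟩ := h.lattice
    have hGle := exponentGroup_le_succ d S e
    have hcG : c ≠ 0 → (e : ℤ) ∈ exponentGroup d S (e + 1) := mem_exponentGroup_succ d
    have hB' : ∀ j i : ℕ, PowerSeries.coeff i (B₁.coeff j) ≠ 0 →
        (i : ℤ) - (e + 1 : ℕ) * (j + 1) - g ∈ exponentGroup d S (e + 1) := by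
      intro j i hi
      rw [hB₁, coeff_C_mul] at hi
      cases i with
      | zero => simp at hi
      | succ i =>
        rw [mul_comm, PowerSeries.coeff_succ_mul_X] at hi
        -- For `B` the lattice value is `k - e (j + 1)`; the extra `e` is absorbed in the base
        -- point.
        have := lattice_blowUp (g := g + e) hGle hcG (A := B) (fun j k hk => by
          have := hB j k hk
          convert this using 1
          ring) j i hi
        convert this using 1
        push_cast
        ring
    have hA' : ∀ j i : ℕ, PowerSeries.coeff i (A₁.coeff j) ≠ 0 →
        (i : ℤ) - (e + 1 : ℕ) * j - g ∈ exponentGroup d S (e + 1) := by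
      intro j i hi
      by_cases h0 : PowerSeries.coeff i ((blowUp c A).coeff j) = 0
      · rw [hA₁', coeff_add, map_add, h0, zero_add] at hi
        cases j with
        | zero => simp at hi
        | succ j =>
          rw [coeff_mul_X] at hi
          exact_mod_cast hB' j i hi
      · exact lattice_blowUp hGle hcG hA j i h0
    refine ⟨g - k, fun j i hi => ?_, fun j i hi => ?_⟩
    · rw [hAc] at hi
      convert hA' j _ hi using 1
      push_cast
      ring
    · rw [hBc] at hi
      convert hB' j _ hi using 1
      push_cast
      ring
  · intro j hj
    rw [hAr]
    exact PowerSeries.X_pow_dvd_iff.mp (hA₁d j) k hj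
  · intro j hj
    rw [hBr, hB₁c]
    exact PowerSeries.X_pow_dvd_iff.mp (dvd_mul_left _ _) k (by omega)

end TailForm
end

/-! ### Descent of the height -/

noncomputable section
open Polynomial

namespace TailForm

variable {d : ℕ} {S : PowerSeries ℂ} {e K : ℕ} {A B : (PowerSeries ℂ)[X]}

/-- A form with linear reduction `(γ + ν β y) + β u y'` keeps this shape, with `ν + 1` instead
of `ν`. -/
theorem exists_linear_step (h : TailForm d S e K A B) (hK : 0 < K) {γ ν β : ℂ} (hβ : β ≠ 0)
    (hA : residue A = C γ + C (ν * β) * X) (hB : residue B = C β) :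
    ∃ A' B' γ', TailForm d S (e + 1) (K - 1) A' B' ∧
      residue A' = C γ' + C ((ν + 1) * β) * X ∧ residue B' = C β := by
  have hev := h.eval_residue hK
  set c := PowerSeries.coeff e S with hc
  obtain ⟨k, hk, A', B', hform, hA0, hB0, hA', hB'⟩ := h.exists_step (l := 1)
    (Or.inr ⟨0, rfl, by rw [hB, taylor_C, coeff_C_zero]; exact hβ⟩)
  rw [← hc] at hA' hB'
  -- For `k = 0` only the constant coefficient of `A'` could survive modulo `u`; it is the value of
  -- `residue A` at its root `c`, against reducedness.
  have hk1 : k = 1 := by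
    rcases Nat.le_one_iff_eq_zero_or_eq_one.mp hk with rfl | rfl
    · exfalso
      have h0 : (residue A').coeff 0 = 0 := by
        have := congrArg (fun p => PowerSeries.constantCoeff (p.coeff 0)) hA'
        simp only [coeff_add, coeff_blowUp, mul_coeff_zero, coeff_X_zero, pow_zero, mul_one, map_one,
          one_mul, mul_zero, zero_mul, add_zero] at this
        rw [coeff_residue, ← this, constantCoeff_coeff_taylor, taylor_coeff_zero, hev]
      have hAz : residue A' = 0 := by
        ext j
        cases j with
        | zero => simpa using h0
        | succ j => simpa using hA0 (j + 1) (Nat.succ_pos j)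
      have hBz : residue B' = 0 := by
        ext j
        simpa using hB0 j (Nat.zero_le j)
      exact hform.reduced.elim (fun h => h hAz) (fun h => h hBz)
    · rfl
  subst hk1
  have hX : (PowerSeries.X : PowerSeries ℂ) ≠ 0 := PowerSeries.X_ne_zero
  have hB1 : B'.coeff 0 = (taylor (PowerSeries.C c) B).coeff 0 := by
    have := congrArg (fun p => p.coeff 0) hB'
    simp only [coeff_C_mul, coeff_blowUp, pow_zero, mul_one, pow_one] at this
    exact (mul_left_cancel₀ hX this).symm
  have hA1 : A'.coeff 1 = (taylor (PowerSeries.C c) A).coeff 1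
      + (taylor (PowerSeries.C c) B).coeff 0 := by
    have := congrArg (fun p => p.coeff 1) hA'
    simp only [mul_assoc, coeff_add, coeff_C_mul, coeff_blowUp, coeff_X_mul, pow_zero, mul_one,
      pow_one] at this
    refine mul_left_cancel₀ hX (this.symm.trans ?_)
    ring
  have hB2 : (residue B').coeff 0 = β := by
    rw [coeff_residue, hB1, constantCoeff_coeff_taylor, hB, taylor_C, coeff_C_zero]
  have hA2 : (residue A').coeff 1 = (ν + 1) * β := by
    rw [coeff_residue, hA1, map_add, constantCoeff_coeff_taylor, constantCoeff_coeff_taylor, hA, hB,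
      map_add, taylor_mul, taylor_C, taylor_C, taylor_C, taylor_X, coeff_add, coeff_C_mul, coeff_add,
      coeff_C_zero, coeff_X_one, coeff_C_succ, coeff_C_succ]
    ring
  refine ⟨A', B', (residue A').coeff 0, hform, ?_, ?_⟩
  · ext j
    rcases j with _ | _ | j
    · simp
    · simp [hA2, coeff_C]
    · rw [hA0 _ (by omega), coeff_add, coeff_C_succ, coeff_C_mul, coeff_X_of_ne_one (by omega)]
      ring
  · ext j
    cases j with
    | zero => simp [hB2]
    | succ j =>
      rw [hB0 _ (by omega)]
      simp

/-- A root `c ≠ 0` of `γ + ν β y` forces `γ ≠ 0`, so two consecutive monomials are present and `e`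
is already in the group. As `ν` grows by one at each step, the linear term never disappears. -/
theorem not_mem_jumpExponents_of_linear (M : ℕ) {γ β : ℂ} {ν : ℕ} (h : TailForm d S e K A B)
    (hK : M < K) (hν : 0 < ν) (hβ : β ≠ 0) (hA : residue A = C γ + C (ν * β) * X)
    (hB : residue B = C β) : ∀ i ∈ Finset.Ico e (e + M), i ∉ jumpExponents d S := by
  induction M generalizing e K A B γ ν with
  | zero => simp
  | succ M ih =>
    intro i hi hjump
    rw [Finset.mem_Ico] at hi
    rcases hi.1.eq_or_lt with rfl | hlt
    · obtain ⟨hc, he⟩ := hjump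
      have hev := h.eval_residue (by omega)
      rw [hA, eval_add, eval_mul, eval_C, eval_C, eval_X] at hev
      have hne : (ν : ℂ) * β ≠ 0 := mul_ne_zero (Nat.cast_ne_zero.mpr hν.ne') hβ
      refine he (h.mem_of_coeff_ne_zero (j := 0) (Or.inl ⟨?_, ?_⟩))
      · rw [hA]
        simp only [coeff_add, coeff_C_zero, coeff_C_mul, coeff_X_zero, mul_zero, add_zero]
        rintro rfl
        rw [zero_add] at hev
        exact mul_ne_zero hne hc hev
      · rw [hA]
        simpa [coeff_C] using hne
    · obtain ⟨A', B', γ', h', hA', hB'⟩ := h.exists_linear_step (by omega) hβ hA hB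
      exact ih h' (by omega) (Nat.succ_pos ν) (by exact_mod_cast hA') hB' i
        (Finset.mem_Ico.mpr (by omega)) hjump

open Classical in
/-- The number of exponents of `S` in `[e, e + M)` outside the group generated by the previous ones
is at most the height of the reduction. -/
theorem card_jumpExponents_le (M H : ℕ) (h : TailForm d S e K A B) (hK : M * H < K)
    (hA : ∀ j, H < j → (residue A).coeff j = 0) (hB : ∀ j, H ≤ j → (residue B).coeff j = 0) :
    ((Finset.Ico e (e + M)).filter (· ∈ jumpExponents d S)).card ≤ H := by
  induction M generalizing e K A B H with
  | zero => simp
  | succ M ih =>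
    have hev := h.eval_residue (by omega)
    have hAdeg : (residue A).natDegree ≤ H := natDegree_le_iff_coeff_eq_zero.mpr hA
    have hsplit : Finset.Ico e (e + (M + 1)) = insert e (Finset.Ico (e + 1) (e + 1 + M)) := by
      ext i
      simp only [Finset.mem_Ico, Finset.mem_insert]
      omega
    rw [hsplit, Finset.filter_insert]
    set c := PowerSeries.coeff e S with hc
    have hstep : ∀ l ≤ H, ((taylor c (residue A)).coeff l ≠ 0 ∨
        ∃ i, l = i + 1 ∧ (taylor c (residue B)).coeff i ≠ 0) →
        ((Finset.Ico (e + 1) (e + 1 + M)).filter (· ∈ jumpExponents d S)).card ≤ l := by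
      intro l hlH hl
      obtain ⟨k, hk, A', B', h', hA', hB', -, -⟩ := h.exists_step hl
      -- A step costs at most `H` orders of precision, which the assumption `M * H < K` pays for.
      refine (ih k h' ?_ hA' hB').trans hk
      have : M * k ≤ M * H := Nat.mul_le_mul_left M (hk.trans hlH)
      rw [Nat.succ_mul] at hK
      omega
    split_ifs with hjump
    · obtain ⟨hcne, he⟩ := hjump
      rw [Finset.card_insert_of_notMem (by simp)]
      have hgap : ∀ j, ¬ ((residue A).coeff j ≠ 0 ∧ (residue A).coeff (j + 1) ≠ 0) := fun j hj =>
        he (h.mem_of_coeff_ne_zero (Or.inl hj))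
      have hgapB : ∀ j, ¬ ((residue B).coeff j ≠ 0 ∧ (residue B).coeff (j + 1) ≠ 0) := fun j hj =>
        he (h.mem_of_coeff_ne_zero (Or.inr hj))
      by_cases hA0 : residue A = 0
      · have hBne : residue B ≠ 0 := h.reduced.resolve_left (not_not.mpr hA0)
        rcases H with _ | _ | H
        · exact absurd (Polynomial.ext fun j => by simpa using hB j (Nat.zero_le j)) hBne
        -- The exceptional case: the jump at `e` uses up the whole count `1`, and the next equation
        -- is linear with `ν = 1`, so no jump follows.
        · have hBC : residue B = C ((residue B).coeff 0) := by
            ext j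
            cases j with
            | zero => simp
            | succ j => simpa [coeff_C] using hB (j + 1) (by omega)
          have hβ : (residue B).coeff 0 ≠ 0 := by
            intro h0
            rw [h0, map_zero] at hBC
            exact hBne hBC
          obtain ⟨A', B', γ', h', hA', hB'⟩ := h.exists_linear_step (γ := 0) (ν := 0) (by omega) hβ
            (by simp [hA0]) hBC
          have := not_mem_jumpExponents_of_linear M (ν := 1) h' (by omega) one_pos hβ
            (by simpa using hA') hB'
          rw [Finset.filter_false_of_mem this]
          simp
        · obtain ⟨l, hl, hne⟩ := exists_coeff_taylor_ne_zero_of_gap (d := H) hBne hcne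
            (natDegree_le_iff_coeff_eq_zero.mpr fun j hj => hB j (by omega)) (hgapB H)
          have := hstep (l + 1) (by omega) (Or.inr ⟨l, rfl, hne⟩)
          omega
      · rcases H with _ | H
        · exfalso
          rw [natDegree_eq_zero.mp (Nat.le_zero.mp hAdeg) |>.choose_spec.symm, eval_C] at hev
          apply hA0
          rw [natDegree_eq_zero.mp (Nat.le_zero.mp hAdeg) |>.choose_spec.symm, hev, map_zero]
        · obtain ⟨l, hl, hne⟩ := exists_coeff_taylor_ne_zero_of_gap (d := H) hA0 hcne hAdeg (hgap H)
          have := hstep l (by omega) (Or.inl hne)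
          omega
    -- No jump at `e`: recentring preserves the leading coefficient, so the order at `c` is at most
    -- the degree and the height does not grow.
    · by_cases hA0 : residue A = 0
      · have hBne : residue B ≠ 0 := h.reduced.resolve_left (not_not.mpr hA0)
        have hlt : (residue B).natDegree < H := by
          by_contra! hle
          exact hBne (leadingCoeff_eq_zero.mp (hB _ hle))
        refine (hstep ((residue B).natDegree + 1) hlt (Or.inr ⟨_, rfl, ?_⟩)).trans hlt
        rw [coeff_taylor_natDegree]
        exact leadingCoeff_ne_zero.mpr hBne
      · refine (hstep _ hAdeg (Or.inl ?_)).trans hAdeg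
        rw [coeff_taylor_natDegree]
        exact leadingCoeff_ne_zero.mpr hA0

end TailForm
end

/-! ### From the 1-form to a truncated equation -/

noncomputable section
open Polynomial

/-- The part of `g(u ^ m, u ^ N * y)` coming from the monomials of `g` of degree `< T` in each
variable. -/
def truncForm (m N T : ℕ) (g : MvPowerSeries (Fin 2) ℂ) : (PowerSeries ℂ)[X] :=
  ∑ i ∈ Finset.range T, ∑ j ∈ Finset.range T,
    C (PowerSeries.monomial (m * i + N * j) (xyCoeff i j g)) * X ^ j

theorem coeff_truncForm {m N T : ℕ} (g : MvPowerSeries (Fin 2) ℂ) (j : ℕ) :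
    (truncForm m N T g).coeff j = if j < T then
      ∑ i ∈ Finset.range T, PowerSeries.monomial (m * i + N * j) (xyCoeff i j g) else 0 := by
  simp only [truncForm, finsetSum_coeff, coeff_C_mul, coeff_X_pow]
  split_ifs with hj
  · refine Finset.sum_congr rfl fun i _ => ?_
    rw [Finset.sum_eq_single j]
    · simp
    · intro b _ hb
      simp [hb.symm]
    · intro h
      exact absurd (Finset.mem_range.mpr hj) h
  · refine Finset.sum_eq_zero fun i _ => Finset.sum_eq_zero fun b hb => ?_
    rw [if_neg, mul_zero]
    rintro rfl
    exact hj (Finset.mem_range.mp hb)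

theorem exists_of_coeff_truncForm_ne_zero {m N T : ℕ} {g : MvPowerSeries (Fin 2) ℂ} {j k : ℕ}
    (h : PowerSeries.coeff k ((truncForm m N T g).coeff j) ≠ 0) :
    ∃ i, k = m * i + N * j ∧ xyCoeff i j g ≠ 0 := by
  rw [coeff_truncForm] at h
  split_ifs at h with hj
  · rw [map_sum] at h
    obtain ⟨i, -, hi⟩ := Finset.exists_ne_zero_of_sum_ne_zero h
    rw [PowerSeries.coeff_monomial] at hi
    split_ifs at hi with hk
    · exact ⟨i, hk, hi⟩
    · exact absurd rfl hi
  · exact absurd (map_zero _) h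

theorem coeff_truncForm_eq {m N T : ℕ} (hm : 0 < m) (g : MvPowerSeries (Fin 2) ℂ) {i j : ℕ}
    (hi : i < T) (hj : j < T) :
    PowerSeries.coeff (m * i + N * j) ((truncForm m N T g).coeff j) = xyCoeff i j g := by
  rw [coeff_truncForm, if_pos hj, map_sum, Finset.sum_eq_single i]
  · simp
  · intro b _ hb
    rw [PowerSeries.coeff_monomial, if_neg]
    intro h
    exact hb (Nat.eq_of_mul_eq_mul_left hm (by omega))
  · intro h
    exact absurd (Finset.mem_range.mpr hi) h

/-- The coefficients of `g(p, q)` for power series `p, q` without constant term. -/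
theorem coeff_subst_pair {p q : PowerSeries ℂ} (hp : PowerSeries.X ∣ p) (hq : PowerSeries.X ∣ q)
    (g : MvPowerSeries (Fin 2) ℂ) {e T : ℕ} (he : e < T) :
    PowerSeries.coeff e (MvPowerSeries.subst ![p, q] g : PowerSeries ℂ)
      = ∑ i ∈ Finset.range T, ∑ j ∈ Finset.range T,
          xyCoeff i j g * PowerSeries.coeff e (p ^ i * q ^ j) := by
  have hsubst : MvPowerSeries.HasSubst (![p, q] : Fin 2 → MvPowerSeries Unit ℂ) := by
    apply MvPowerSeries.hasSubst_of_constantCoeff_zero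
    intro s
    fin_cases s
    · exact PowerSeries.X_dvd_iff.mp hp
    · exact PowerSeries.X_dvd_iff.mp hq
  have hbij : Function.Bijective
      (fun z : ℕ × ℕ => (Finsupp.single 0 z.1 + Finsupp.single 1 z.2 : Fin 2 →₀ ℕ)) := by
    refine ⟨fun z w h => ?_, fun d => ⟨(d 0, d 1), ?_⟩⟩
    · have h0 := DFunLike.congr_fun h 0
      have h1 := DFunLike.congr_fun h 1
      simp at h0 h1
      exact Prod.ext h0 h1
    · ext i
      fin_cases i <;> simp
  rw [PowerSeries.coeff, MvPowerSeries.coeff_subst hsubst]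
  rw [← finsum_eq_of_bijective (f := fun z : ℕ × ℕ =>
    xyCoeff z.1 z.2 g * PowerSeries.coeff e (p ^ z.1 * q ^ z.2)) _ hbij]
  · rw [finsum_eq_sum_of_support_subset (s := Finset.range T ×ˢ Finset.range T),
      Finset.sum_product]
    · rfl
    · intro z hz
      rw [Function.mem_support] at hz
      have h1 : PowerSeries.X ^ (z.1 + z.2) ∣ p ^ z.1 * q ^ z.2 := by
        rw [pow_add]
        exact mul_dvd_mul (pow_dvd_pow_of_dvd hp _) (pow_dvd_pow_of_dvd hq _)
      have h2 : z.1 + z.2 ≤ e := by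
        by_contra! hlt
        exact hz (by rw [PowerSeries.X_pow_dvd_iff.mp h1 e hlt, mul_zero])
      simp only [Finset.coe_product, Finset.coe_range, Set.mem_prod, Set.mem_Iio]
      omega
  · rintro ⟨i, j⟩
    rw [Finsupp.prod_fintype _ _ (by simp), Fin.prod_univ_two]
    simp [xyCoeff, PowerSeries.coeff]

theorem X_pow_mul_tailSeries {S : PowerSeries ℂ} {e : ℕ}
    (h : ∀ k < e, PowerSeries.coeff k S = 0) : PowerSeries.X ^ e * tailSeries S e = S := by
  ext k
  rw [PowerSeries.coeff_X_pow_mul']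
  split_ifs with hk
  · simp [tailSeries, Nat.sub_add_cancel hk]
  · exact (h k (by omega)).symm

/-- Truncation makes the equation polynomial in `y`. As `m, N ≥ 1`, a discarded monomial has order
at least `T` in `u` on the branch. -/
theorem dvd_subst_sub_eval_truncForm {m N T : ℕ} (hm : 0 < m) (hN : 0 < N) {S : PowerSeries ℂ}
    (hS : ∀ k < N, PowerSeries.coeff k S = 0) (g : MvPowerSeries (Fin 2) ℂ) :
    PowerSeries.X ^ T ∣ (MvPowerSeries.subst ![PowerSeries.X ^ m, S] g : PowerSeries ℂ)
      - (truncForm m N T g).eval (tailSeries S N) := by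
  have hX : PowerSeries.X ∣ (PowerSeries.X ^ m : PowerSeries ℂ) := dvd_pow_self _ hm.ne'
  have hXS : PowerSeries.X ∣ S := by
    rw [PowerSeries.X_dvd_iff, ← PowerSeries.coeff_zero_eq_constantCoeff_apply]
    exact hS 0 hN
  rw [PowerSeries.X_pow_dvd_iff]
  intro e he
  rw [map_sub, coeff_subst_pair hX hXS g he, sub_eq_zero, truncForm, eval_finsetSum, map_sum]
  refine Finset.sum_congr rfl fun i _ => ?_
  rw [eval_finsetSum, map_sum]
  refine Finset.sum_congr rfl fun j _ => ?_
  rw [← PowerSeries.coeff_C_mul]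
  congr 1
  have hmon : PowerSeries.monomial (m * i + N * j) (xyCoeff i j g)
      = PowerSeries.C (xyCoeff i j g) * PowerSeries.X ^ (m * i + N * j) := by
    ext k
    rw [PowerSeries.coeff_C_mul, PowerSeries.coeff_X_pow, PowerSeries.coeff_monomial]
    simp
  rw [eval_mul, eval_C, eval_pow, eval_X, hmon]
  nth_rw 1 [← X_pow_mul_tailSeries hS]
  ring

theorem eulerDeriv_X_pow_mul (N : ℕ) (t : PowerSeries ℂ) :
    eulerDeriv (PowerSeries.X ^ N * t)
      = PowerSeries.X ^ N * (PowerSeries.C (N : ℂ) * t + eulerDeriv t) := by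
  ext k
  rw [coeff_eulerDeriv, PowerSeries.coeff_X_pow_mul', PowerSeries.coeff_X_pow_mul']
  split_ifs with h
  · rw [map_add, PowerSeries.coeff_C_mul, coeff_eulerDeriv, Nat.cast_sub h]
    ring
  · simp

section Branch

variable {n m : ℕ} {f : PowerSeries ℂ}

/-- A branch in the variable `x^{1/m}`, written in the variable `x^{1/(nm)}`. -/
def ramified (n : ℕ) (f : PowerSeries ℂ) : PowerSeries ℂ :=
  f.subst (PowerSeries.X ^ n : PowerSeries ℂ)

theorem coeff_ramified (hn : 0 < n) (f : PowerSeries ℂ) (k : ℕ) :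
    PowerSeries.coeff k (ramified n f) = if n ∣ k then PowerSeries.coeff (k / n) f else 0 := by
  rw [ramified, PowerSeries.coeff_subst_X_pow hn.ne']
  rfl

theorem coeff_ramified_of_lt (hn : 0 < n) (hf : IsTransverse m f) :
    ∀ k < n * m, PowerSeries.coeff k (ramified n f) = 0 := by
  intro k hk
  rw [coeff_ramified hn]
  split_ifs
  · exact hf _ ((Nat.div_lt_iff_lt_mul hn).mpr (by rwa [mul_comm]))
  · rfl

theorem X_pow_mul_branchDeriv (hn : 0 < n) (hm : 0 < m) (hf : IsTransverse m f) :
    PowerSeries.X ^ (n * m) * (PowerSeries.C ((n * m : ℕ) : ℂ) * ramified n (branchDeriv m f))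
      = eulerDeriv (ramified n f) := by
  ext k
  rw [PowerSeries.coeff_X_pow_mul', coeff_eulerDeriv]
  split_ifs with hk
  · obtain ⟨l, rfl⟩ := Nat.exists_eq_add_of_le hk
    rw [Nat.add_sub_cancel_left, PowerSeries.coeff_C_mul, coeff_ramified hn, coeff_ramified hn]
    by_cases hl : n ∣ l
    · obtain ⟨l, rfl⟩ := hl
      have hm' : (m : ℂ) ≠ 0 := Nat.cast_ne_zero.mpr hm.ne'
      rw [← mul_add, if_pos (Dvd.intro _ rfl), if_pos (Dvd.intro _ rfl), Nat.mul_div_cancel_left _ hn,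
        Nat.mul_div_cancel_left _ hn, branchDeriv, PowerSeries.coeff_mk, add_comm m l]
      push_cast
      field_simp
    · rw [if_neg hl, if_neg (by rwa [← Nat.dvd_add_right (Dvd.intro m rfl)] at hl)]
      simp
  · rw [coeff_ramified_of_lt hn hf k (by omega), mul_zero]

/-- This is `N s' = N t + u t'` for `s = u^N t`, after cancelling `u^N = x`. -/
theorem mul_ramified_branchDeriv (hn : 0 < n) (hm : 0 < m) (hf : IsTransverse m f) :
    PowerSeries.C ((n * m : ℕ) : ℂ) * ramified n (branchDeriv m f)
      = PowerSeries.C ((n * m : ℕ) : ℂ) * tailSeries (ramified n f) (n * m)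
        + eulerDeriv (tailSeries (ramified n f) (n * m)) := by
  refine mul_left_cancel₀ (pow_ne_zero (n * m) PowerSeries.X_ne_zero) ?_
  rw [X_pow_mul_branchDeriv hn hm hf, ← eulerDeriv_X_pow_mul,
    X_pow_mul_tailSeries (coeff_ramified_of_lt hn hf)]

end Branch

namespace FormalOneForm

variable {n : ℕ} (ω : FormalOneForm n)

/-- `k / n` is the smallest weight `i / n + j` of the monomials `x^{i/n} y^j` of the coefficients,
and `H` is the largest ordinate of the points of the cloud coming from monomials of this weight. -/
structure IsInitialRow (k H : ℕ) : Prop where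
  le_a : ∀ i j, xyCoeff i j ω.a ≠ 0 → k ≤ i + n * j
  le_b : ∀ i j, xyCoeff i j ω.b ≠ 0 → k ≤ i + n * j
  height_a : ∀ i j, xyCoeff i j ω.a ≠ 0 → i + n * j = k → j ≤ H
  height_b : ∀ i j, xyCoeff i j ω.b ≠ 0 → i + n * j = k → j + 1 ≤ H
  attained : ∃ i j, i + n * j = k ∧
    ((xyCoeff i j ω.a ≠ 0 ∧ j = H) ∨ (xyCoeff i j ω.b ≠ 0 ∧ j + 1 = H))

variable {ω}

theorem IsInitialRow.exists_tailForm {k H m : ℕ} {f : PowerSeries ℂ} (h : ω.IsInitialRow k H)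
    (hn : 0 < n) (hm : 0 < m) (hf : IsTransverse m f) (hinv : ω.IsInvariant m f) (K : ℕ) :
    ∃ K' ≥ K, ∃ A B, TailForm m (ramified n f) (n * m) K' A B ∧
      (∀ j, H < j → (residue A).coeff j = 0) ∧ ∀ j, H ≤ j → (residue B).coeff j = 0 := by
  -- Large enough to keep every monomial of weight `k / n` (its indices are at most `k`) and
  -- precision `K` after division by `u^{mk}`.
  set T := m * k + K + k + 1 with hT
  set N := n * m with hN
  have hNpos : 0 < N := Nat.mul_pos hn hm
  set a := truncForm m N T ω.a with ha
  set b := truncForm m N T ω.b with hb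
  set A₁ := C (PowerSeries.C (N : ℂ)) * (a + b * X) with hA₁
  have hwt : ∀ i j, m * i + N * j = m * (i + n * j) := fun i j => by rw [hN]; ring
  have hA₁c : ∀ j l, PowerSeries.coeff l (A₁.coeff j) ≠ 0 →
      (∃ i, l = m * i + N * j ∧ xyCoeff i j ω.a ≠ 0) ∨
        ∃ i j', j = j' + 1 ∧ l = m * i + N * j' ∧ xyCoeff i j' ω.b ≠ 0 := by
    intro j l hl
    rw [hA₁, coeff_C_mul, PowerSeries.coeff_C_mul, coeff_add, map_add] at hl
    by_cases h0 : PowerSeries.coeff l (a.coeff j) = 0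
    · right
      rw [h0, zero_add] at hl
      cases j with
      | zero => simp at hl
      | succ j =>
        rw [coeff_mul_X] at hl
        obtain ⟨i, hi⟩ := exists_of_coeff_truncForm_ne_zero (right_ne_zero_of_mul hl)
        exact ⟨i, j, rfl, hi⟩
    · exact Or.inl (exists_of_coeff_truncForm_ne_zero h0)
  obtain ⟨A, hA⟩ : C (PowerSeries.X ^ (m * k)) ∣ A₁ := by
    rw [C_dvd_iff_dvd_coeff]
    refine fun j => PowerSeries.X_pow_dvd_iff.mpr fun l hl => ?_
    by_contra h0
    rcases hA₁c j l h0 with ⟨i, rfl, hi⟩ | ⟨i, j', rfl, rfl, hi⟩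
    · rw [hwt] at hl
      exact absurd (h.le_a _ _ hi) (not_le.mpr (lt_of_mul_lt_mul_left' hl))
    · rw [hwt] at hl
      exact absurd (h.le_b _ _ hi) (not_le.mpr (lt_of_mul_lt_mul_left' hl))
  obtain ⟨B, hB⟩ : C (PowerSeries.X ^ (m * k)) ∣ b := by
    rw [C_dvd_iff_dvd_coeff]
    refine fun j => PowerSeries.X_pow_dvd_iff.mpr fun l hl => ?_
    by_contra h0
    obtain ⟨i, rfl, hi⟩ := exists_of_coeff_truncForm_ne_zero h0
    rw [hwt] at hl
    exact absurd (h.le_b _ _ hi) (not_le.mpr (lt_of_mul_lt_mul_left' hl))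
  have hAc : ∀ j i, PowerSeries.coeff i (A.coeff j)
      = PowerSeries.coeff (i + m * k) (A₁.coeff j) := by
    intro j i
    rw [hA, coeff_C_mul, PowerSeries.coeff_X_pow_mul]
  have hBc : ∀ j i, PowerSeries.coeff i (B.coeff j)
      = PowerSeries.coeff (i + m * k) (b.coeff j) := by
    intro j i
    rw [hB, coeff_C_mul, PowerSeries.coeff_X_pow_mul]
  have hAr : ∀ j, (residue A).coeff j = PowerSeries.coeff (m * k) (A₁.coeff j) := by
    intro j
    rw [coeff_residue, ← PowerSeries.coeff_zero_eq_constantCoeff_apply, hAc, zero_add]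
  have hBr : ∀ j, (residue B).coeff j = PowerSeries.coeff (m * k) (b.coeff j) := by
    intro j
    rw [coeff_residue, ← PowerSeries.coeff_zero_eq_constantCoeff_apply, hBc, zero_add]
  have hmem : (m : ℤ) ∈ exponentGroup m (ramified n f) N :=
    AddSubgroup.subset_closure (Set.mem_insert _ _)
  -- In the variable `u` all exponents of the form, and `N` itself, are multiples of `m`.
  have hmem' : ∀ z : ℤ, (m : ℤ) * z ∈ exponentGroup m (ramified n f) N := by
    intro z
    have := AddSubgroup.zsmul_mem _ hmem z
    rwa [smul_eq_mul, mul_comm] at this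
  refine ⟨T - m * k, by omega, A, B, ⟨?_, ?_, ⟨-(m * k : ℕ), ?_, ?_⟩⟩, ?_, ?_⟩
  -- The two parts of `A₁` may cancel only if `b` has a monomial of minimal weight, and then
  -- `residue B` is nonzero.
  · by_contra! hzero
    have hb0 : ∀ i j, i + n * j = k → xyCoeff i j ω.b = 0 := by
      intro i j hij
      have hj : j ≤ n * j := Nat.le_mul_of_pos_left j hn
      rw [← coeff_truncForm_eq (N := N) (T := T) hm ω.b (by omega) (by omega), ← hb, hwt, hij, ← hBr,
        hzero.2, coeff_zero]
    obtain ⟨i, j, hij, ⟨hi, -⟩ | ⟨hi, -⟩⟩ := h.attained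
    · have hj : j ≤ n * j := Nat.le_mul_of_pos_left j hn
      have h1 := hAr j
      rw [hzero.1, coeff_zero, hA₁, coeff_C_mul, PowerSeries.coeff_C_mul, coeff_add, map_add, ← hij,
        ← hwt, ha, coeff_truncForm_eq hm ω.a (by omega) (by omega), hwt, hij] at h1
      have h2 : PowerSeries.coeff (m * k) ((b * X).coeff j) = 0 := by
        cases j with
        | zero => simp
        | succ j => rw [coeff_mul_X, ← hBr, hzero.2, coeff_zero]
      rw [h2, add_zero] at h1
      exact mul_ne_zero (Nat.cast_ne_zero.mpr hNpos.ne') hi h1.symm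
    · exact hi (hb0 i j hij)
  · set t := tailSeries (ramified n f) N with ht
    have hS := coeff_ramified_of_lt hn hf
    have e1 := dvd_subst_sub_eval_truncForm (T := T) hm hNpos hS ω.a
    have e2 := dvd_subst_sub_eval_truncForm (T := T) hm hNpos hS ω.b
    have e3 : MvPowerSeries.subst ![PowerSeries.X ^ m, ramified n f] ω.a
        + MvPowerSeries.subst ![PowerSeries.X ^ m, ramified n f] ω.b
          * ramified n (branchDeriv m f) = 0 := hinv
    have e4 := mul_ramified_branchDeriv hn hm hf
    rw [← ht, ← ha] at e1
    rw [← ht, ← hb] at e2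
    rw [← hN, ← ht] at e4
    set α : PowerSeries ℂ := MvPowerSeries.subst ![PowerSeries.X ^ m, ramified n f] ω.a
    set β : PowerSeries ℂ := MvPowerSeries.subst ![PowerSeries.X ^ m, ramified n f] ω.b
    have e5 : PowerSeries.X ^ T ∣ A₁.eval t + b.eval t * eulerDeriv t := by
      have h1 := dvd_add (Dvd.dvd.mul_left e1 (-PowerSeries.C (N : ℂ)))
        (Dvd.dvd.mul_left e2 (-(PowerSeries.C (N : ℂ) * t + eulerDeriv t)))
      convert h1 using 1
      rw [hA₁, eval_mul, eval_add, eval_C, eval_mul, eval_X]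
      linear_combination PowerSeries.C (N : ℂ) * e3 - β * e4
    have e6 : A₁.eval t + b.eval t * eulerDeriv t
        = PowerSeries.X ^ (m * k) * (A.eval t + B.eval t * eulerDeriv t) := by
      rw [hA, hB, eval_mul, eval_mul, eval_C]
      ring
    have e7 : T = m * k + (T - m * k) := by omega
    rw [e6, e7, pow_add] at e5
    exact (mul_dvd_mul_iff_left (pow_ne_zero _ PowerSeries.X_ne_zero)).mp e5
  · intro j l hl
    rw [hAc] at hl
    rcases hA₁c _ _ hl with ⟨i, hi, -⟩ | ⟨i, j', rfl, hi, -⟩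
    · convert hmem' i using 1
      have : (l : ℤ) + (m * k : ℕ) = m * i + N * j := by exact_mod_cast hi
      linear_combination this
    · convert hmem' (i - n) using 1
      have : (l : ℤ) + (m * k : ℕ) = m * i + N * j' := by exact_mod_cast hi
      have hN' : (N : ℤ) = n * m := by exact_mod_cast hN
      push_cast at this ⊢
      linear_combination this - hN'
  · intro j l hl
    rw [hBc] at hl
    obtain ⟨i, hi, -⟩ := exists_of_coeff_truncForm_ne_zero hl
    convert hmem' (i - n) using 1
    have : (l : ℤ) + (m * k : ℕ) = m * i + N * j := by exact_mod_cast hi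
    have hN' : (N : ℤ) = n * m := by exact_mod_cast hN
    push_cast at this ⊢
    linear_combination this - hN'
  · intro j hj
    by_contra h0
    rw [hAr] at h0
    rcases hA₁c _ _ h0 with ⟨i, hi, hne⟩ | ⟨i, j', rfl, hi, hne⟩
    · rw [hwt] at hi
      have := h.height_a _ _ hne (Nat.eq_of_mul_eq_mul_left hm hi).symm
      omega
    · rw [hwt] at hi
      have := h.height_b _ _ hne (Nat.eq_of_mul_eq_mul_left hm hi).symm
      omega
  · intro j hj
    by_contra h0
    rw [hBr] at h0
    obtain ⟨i, hi, hne⟩ := exists_of_coeff_truncForm_ne_zero h0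
    rw [hwt] at hi
    have := h.height_b _ _ hne (Nat.eq_of_mul_eq_mul_left hm hi).symm
    omega

end FormalOneForm

end

/-! ### Puiseux exponents as jump exponents in the ramified variable -/

noncomputable section

/-- Division by `N`, as a homomorphism `ℤ → ℚ`. -/
def intDivHom (N : ℕ) : ℤ →+ ℚ where
  toFun z := (z : ℚ) / N
  map_zero' := by simp
  map_add' x y := by
    push_cast
    ring

theorem intDivHom_injective {N : ℕ} (hN : 0 < N) : Function.Injective (intDivHom N) := by
  intro x y h
  have hN' : (N : ℚ) ≠ 0 := Nat.cast_ne_zero.mpr hN.ne'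
  exact_mod_cast (div_left_inj' hN').mp h

section Branch

variable {n m : ℕ}

theorem intDivHom_mul (hn : 0 < n) (k : ℕ) :
    intDivHom (n * m) ((n * k : ℕ) : ℤ) = (k : ℚ) / m := by
  have hn' : (n : ℚ) ≠ 0 := Nat.cast_ne_zero.mpr hn.ne'
  change (((n * k : ℕ) : ℤ) : ℚ) / ((n * m : ℕ) : ℚ) = k / m
  push_cast
  rw [mul_div_mul_left _ _ hn']

theorem map_exponentGroup_ramified (hn : 0 < n) (hm : 0 < m) (f : PowerSeries ℂ) (k : ℕ) :
    (exponentGroup m (ramified n f) (n * k)).map (intDivHom (n * m))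
      = AddSubgroup.closure (insert (1 / (n : ℚ))
          {ν | ∃ l < k, PowerSeries.coeff l f ≠ 0 ∧ ν = (l : ℚ) / (m : ℚ)}) := by
  rw [exponentGroup, AddMonoidHom.map_closure, Set.image_insert_eq]
  have hm' : (m : ℚ) ≠ 0 := Nat.cast_ne_zero.mpr hm.ne'
  have hn' : (n : ℚ) ≠ 0 := Nat.cast_ne_zero.mpr hn.ne'
  have h1 : intDivHom (n * m) (m : ℤ) = 1 / (n : ℚ) := by
    change ((m : ℤ) : ℚ) / ((n * m : ℕ) : ℚ) = 1 / n
    push_cast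
    field_simp
  rw [h1]
  congr 2
  ext ν
  constructor
  · rintro ⟨z, ⟨l, hl, hne, rfl⟩, rfl⟩
    rw [coeff_ramified hn] at hne
    split_ifs at hne with hdvd
    · obtain ⟨l, rfl⟩ := hdvd
      rw [Nat.mul_div_cancel_left _ hn] at hne
      exact ⟨l, lt_of_mul_lt_mul_left' hl, hne, intDivHom_mul hn l⟩
    · exact absurd rfl hne
  · rintro ⟨l, hl, hne, rfl⟩
    refine ⟨((n * l : ℕ) : ℤ), ⟨n * l, Nat.mul_lt_mul_of_pos_left hl hn, ?_, rfl⟩,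
      intDivHom_mul hn l⟩
    rwa [coeff_ramified hn, if_pos (Dvd.intro _ rfl), Nat.mul_div_cancel_left _ hn]

/-- Multiplication by `n m` turns `1/n` into `m` and `k/m` into `n k`; all exponents of the ramified
series are divisible by `n`. -/
theorem puiseuxExponents_eq_image (hn : 0 < n) (hm : 0 < m) (f : PowerSeries ℂ) :
    puiseuxExponents n m f
      = (fun k : ℕ => intDivHom (n * m) k) '' jumpExponents m (ramified n f) := by
  have hinj := intDivHom_injective (Nat.mul_pos hn hm)
  ext μ
  constructor
  · rintro ⟨k, rfl, hne, hnot⟩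
    refine ⟨n * k, ⟨?_, fun hmem => hnot ?_⟩, intDivHom_mul hn k⟩
    · rwa [coeff_ramified hn, if_pos (Dvd.intro _ rfl), Nat.mul_div_cancel_left _ hn]
    · rw [← map_exponentGroup_ramified hn hm, ← intDivHom_mul hn]
      exact AddSubgroup.mem_map_of_mem _ hmem
  · rintro ⟨k, ⟨hne, hnot⟩, rfl⟩
    rw [coeff_ramified hn] at hne
    split_ifs at hne with hdvd
    · obtain ⟨k, rfl⟩ := hdvd
      rw [Nat.mul_div_cancel_left _ hn] at hne
      refine ⟨k, intDivHom_mul hn k, hne, fun hmem => hnot ?_⟩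
      rw [← map_exponentGroup_ramified hn hm] at hmem
      exact (AddSubgroup.mem_map_iff_mem hinj).mp hmem
    · exact absurd rfl hne

end Branch

theorem Set.finite_and_ncard_le_of_forall_finset {α : Type*} {E : Set α} {H : ℕ}
    (h : ∀ t : Finset α, (t : Set α) ⊆ E → t.card ≤ H) : E.Finite ∧ E.ncard ≤ H := by
  have hfin : E.Finite := by
    by_contra hinf
    obtain ⟨t, ht, hcard⟩ := Set.Infinite.exists_subset_card_eq hinf (H + 1)
    have := h t ht
    omega
  refine ⟨hfin, ?_⟩
  rw [Set.ncard_eq_toFinset_card _ hfin]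
  exact h _ (by simp)

theorem xyCoeff_ne_zero_of_ne_zero {g : MvPowerSeries (Fin 2) ℂ} (h : g ≠ 0) :
    ∃ i j, xyCoeff i j g ≠ 0 := by
  obtain ⟨d, hd⟩ := (MvPowerSeries.ne_zero_iff_exists_coeff_ne_zero g).mp h
  refine ⟨d 0, d 1, ?_⟩
  have : Finsupp.single 0 (d 0) + Finsupp.single 1 (d 1) = d := by
    ext i
    fin_cases i <;> simp
  rwa [xyCoeff, this]

/-! ### The Newton polygon, the `y`-order and the multiplicity -/

/-- The points of the plane above the line `p.1 + p.2 = τ`, or on it with ordinate at most `H`. -/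
theorem convex_lex_halfPlane (τ H : ℝ) :
    Convex ℝ {p : ℝ × ℝ | τ < p.1 + p.2 ∨ (τ = p.1 + p.2 ∧ p.2 ≤ H)} := by
  rw [convex_iff_forall_pos]
  rintro ⟨x, y⟩ hp ⟨z, w⟩ hq s t hs ht hst
  simp only [Set.mem_ofPred_eq, Prod.smul_mk, Prod.mk_add_mk, smul_eq_mul] at *
  obtain rfl : t = 1 - s := by linarith
  rcases hp with hp | ⟨hp, hp'⟩ <;> rcases hq with hq | ⟨hq, hq'⟩
  · left; nlinarith
  · left; nlinarith
  · left; nlinarith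
  · right
    constructor
    · linear_combination s * hp + (1 - s) * hq
    · nlinarith

namespace FormalOneForm

variable {n : ℕ} {ω : FormalOneForm n}

theorem exists_isInitialRow (hn : 0 < n) (hne : ω.a ≠ 0 ∨ ω.b ≠ 0) :
    ∃ k H, ω.IsInitialRow k H := by
  classical
  have hex : ∃ k, ∃ i j, i + n * j = k ∧ (xyCoeff i j ω.a ≠ 0 ∨ xyCoeff i j ω.b ≠ 0) := by
    rcases hne with h | h
    · obtain ⟨i, j, hij⟩ := xyCoeff_ne_zero_of_ne_zero h
      exact ⟨_, i, j, rfl, Or.inl hij⟩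
    · obtain ⟨i, j, hij⟩ := xyCoeff_ne_zero_of_ne_zero h
      exact ⟨_, i, j, rfl, Or.inr hij⟩
  set k := Nat.find hex with hk
  let Q : ℕ → Prop := fun h => ∃ i j, i + n * j = k ∧
    ((xyCoeff i j ω.a ≠ 0 ∧ j = h) ∨ (xyCoeff i j ω.b ≠ 0 ∧ j + 1 = h))
  -- The extra `1` comes from `b`, whose monomials are raised by one in the cloud.
  have hQle : ∀ h, Q h → h ≤ k + 1 := by
    rintro h ⟨i, j, hij, h1⟩
    have hj : j ≤ n * j := Nat.le_mul_of_pos_left j hn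
    rcases h1 with ⟨-, rfl⟩ | ⟨-, rfl⟩ <;> omega
  have hQex : ∃ h, Q h := by
    obtain ⟨i, j, hij, h | h⟩ := Nat.find_spec hex
    · exact ⟨j, i, j, hij, Or.inl ⟨h, rfl⟩⟩
    · exact ⟨j + 1, i, j, hij, Or.inr ⟨h, rfl⟩⟩
  have hQmax : ∀ h, Q h → h ≤ Nat.findGreatest Q (k + 1) := fun h hQ =>
    Nat.le_findGreatest (hQle h hQ) hQ
  refine ⟨k, Nat.findGreatest Q (k + 1), ?_, ?_, ?_, ?_, ?_⟩
  · exact fun i j h => Nat.find_min' hex ⟨i, j, rfl, Or.inl h⟩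
  · exact fun i j h => Nat.find_min' hex ⟨i, j, rfl, Or.inr h⟩
  · exact fun i j h hij => hQmax j ⟨i, j, hij, Or.inl ⟨h, rfl⟩⟩
  · exact fun i j h hij => hQmax (j + 1) ⟨i, j, hij, Or.inr ⟨h, rfl⟩⟩
  · obtain ⟨h, hQ⟩ := hQex
    exact Nat.findGreatest_spec (P := Q) (hQle h hQ) hQ

namespace IsInitialRow

variable {k H : ℕ}

theorem finite_puiseuxExponents (h : ω.IsInitialRow k H) (hn : 0 < n) {m : ℕ} (hm : 0 < m)
    {f : PowerSeries ℂ} (hf : IsTransverse m f) (hinv : ω.IsInvariant m f) :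
    (puiseuxExponents n m f).Finite ∧ (puiseuxExponents n m f).ncard ≤ H := by
  classical
  have hE : (jumpExponents m (ramified n f)).Finite ∧
      (jumpExponents m (ramified n f)).ncard ≤ H := by
    refine Set.finite_and_ncard_le_of_forall_finset fun t ht => ?_
    -- The precision needed depends on the window, so each finite set of jumps is bounded
    -- separately; the uniform bound `H` then gives finiteness.
    set M := t.sup id + 1 with hM
    obtain ⟨K, hK, A, B, hform, hA, hB⟩ := h.exists_tailForm hn hm hf hinv (M * H + 1)
    refine (Finset.card_le_card fun i hi => ?_).trans
      (hform.card_jumpExponents_le M H hK hA hB)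
    have hiE := ht hi
    rw [Finset.mem_filter, Finset.mem_Ico]
    refine ⟨⟨?_, ?_⟩, hiE⟩
    · by_contra! hlt
      exact hiE.1 (coeff_ramified_of_lt hn hf i hlt)
    · have : i ≤ t.sup id := Finset.le_sup (f := id) hi
      omega
  rw [puiseuxExponents_eq_image hn hm]
  exact ⟨hE.1.image _, (Set.ncard_image_le hE.1).trans hE.2⟩

/-- A monomial of minimal weight `k/n` realizing `H` has ordinate `j₀ ≤ k/n`, and `H ≤ j₀ + 1`. -/
theorem le_multiplicity (h : ω.IsInitialRow k H) (hn : 0 < n) : (H : ℝ≥0∞) ≤ ω.multiplicity := by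
  obtain ⟨i₀, j₀, hij, h0⟩ := h.attained
  have hH : H ≤ j₀ + 1 := by
    rcases h0 with ⟨-, rfl⟩ | ⟨-, rfl⟩ <;> omega
  have hn0 : (n : ℝ≥0∞) ≠ 0 := Nat.cast_ne_zero.mpr hn.ne'
  have hn1 : (n : ℝ≥0∞) ≠ ⊤ := ENNReal.natCast_ne_top n
  have key : ∀ i j : ℕ, k ≤ i + n * j → (j₀ : ℝ≥0∞) ≤ (i : ℝ≥0∞) / n + j := by
    intro i j hk
    have h1 : (i : ℝ≥0∞) / n + j = ((i + n * j : ℕ) : ℝ≥0∞) / n := by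
      push_cast
      rw [ENNReal.add_div, ENNReal.mul_div_right_comm, ENNReal.div_self hn0 hn1, one_mul]
    rw [h1, ENNReal.le_div_iff_mul_le (Or.inl hn0) (Or.inl hn1)]
    have : j₀ * n ≤ i + n * j := by rw [mul_comm]; omega
    exact_mod_cast this
  have h1 : (H : ℝ≥0∞) ≤ (j₀ : ℝ≥0∞) + 1 := by exact_mod_cast hH
  refine h1.trans (add_le_add_left (le_min ?_ ?_) 1)
  · exact le_iInf fun i => le_iInf fun j => le_iInf fun hne => key i j (h.le_a i j hne)
  · exact le_iInf fun i => le_iInf fun j => le_iInf fun hne => key i j (h.le_b i j hne)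

/-- The lexicographic half-plane is convex and contains every quadrant, so taking the hull creates
no higher point on the line. -/
theorem newtonPolygon_subset (h : ω.IsInitialRow k H) (hn : 0 < n) :
    ω.newtonPolygon ⊆
      {p : ℝ × ℝ | (k : ℝ) / n < p.1 + p.2 ∨ ((k : ℝ) / n = p.1 + p.2 ∧ p.2 ≤ H)} := by
  have hn' : (0 : ℝ) < n := Nat.cast_pos.mpr hn
  refine convexHull_min ?_ (convex_lex_halfPlane _ _)
  rintro ⟨x, y⟩ ⟨p, ⟨i, j, hp⟩, hx, hy⟩
  have hcast : (i : ℝ) / n + j = ((i + n * j : ℕ) : ℝ) / n := by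
    push_cast
    field_simp
  have key : ∀ {c : ℝ}, k ≤ i + n * j → (i + n * j = k → (j : ℝ) + c ≤ H) →
      (i : ℝ) / n - c ≤ x → (j : ℝ) + c ≤ y →
      (k : ℝ) / n < x + y ∨ ((k : ℝ) / n = x + y ∧ y ≤ H) := by
    intro c hk hH hx hy
    rcases hk.eq_or_lt with heq | hlt
    · have h1 : (k : ℝ) / n = i / n + j := by rw [hcast, heq]
      rcases (show (k : ℝ) / n ≤ x + y by linarith).lt_or_eq with h2 | h2
      · exact Or.inl h2
      · have := hH heq.symm
        exact Or.inr ⟨h2, by linarith⟩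
    · left
      have h1 : (k : ℝ) / n < i / n + j := by
        rw [hcast]
        exact div_lt_div_of_pos_right (Nat.cast_lt.mpr hlt) hn'
      linarith
  rcases hp with ⟨hne, rfl⟩ | ⟨hne, rfl⟩
  · exact key (c := 0) (h.le_a i j hne)
      (fun e => by simpa using h.height_a i j hne e) (by simpa using hx) (by simpa using hy)
  · exact key (c := 1) (h.le_b i j hne)
      (fun e => by exact_mod_cast h.height_b i j hne e) hx hy

theorem exists_mem_cloud (h : ω.IsInitialRow k H) (hn : 0 < n) :
    ((k : ℝ) / n - H, (H : ℝ)) ∈ ω.cloud := by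
  have hn' : (n : ℝ) ≠ 0 := Nat.cast_ne_zero.mpr hn.ne'
  obtain ⟨i, j, hij, h0⟩ := h.attained
  have hk : (k : ℝ) / n = i / n + j := by
    rw [← hij]
    push_cast
    field_simp
  refine ⟨i, j, ?_⟩
  rcases h0 with ⟨hne, rfl⟩ | ⟨hne, rfl⟩
  · exact Or.inl ⟨hne, Prod.ext (by simp [hk]) rfl⟩
  · refine Or.inr ⟨hne, Prod.ext ?_ ?_⟩
    · simp only [hk]
      push_cast
      ring
    · push_cast
      rfl

theorem quadrant_subset (h : ω.IsInitialRow k H) (hn : 0 < n) {q : ℝ × ℝ}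
    (h1 : (k : ℝ) / n - H ≤ q.1) (h2 : (H : ℝ) ≤ q.2) : q ∈ ω.newtonPolygon :=
  subset_convexHull ℝ _ ⟨_, h.exists_mem_cloud hn, h1, h2⟩

theorem isSupportingLine_iff (h : ω.IsInitialRow k H) (hn : 0 < n) {τ : ℝ} :
    ω.IsSupportingLine (coslopeLine 1 τ) ↔ τ = (k : ℝ) / n := by
  constructor
  · rintro ⟨⟨p, hp, hpL⟩, hfr⟩
    have hp' := h.newtonPolygon_subset hn hp
    have hpL' : p.1 + 1 * p.2 = τ := hpL
    rw [one_mul] at hpL'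
    have hle : (k : ℝ) / n ≤ τ := by
      rcases hp' with h1 | ⟨h1, -⟩ <;> linarith
    by_contra hne
    have hlt : (k : ℝ) / n < τ := lt_of_le_of_ne hle (Ne.symm hne)
    -- The vertex `(k/n - H, H)` moved diagonally onto the line; it lands inside the open quadrant.
    let q : ℝ × ℝ := ((k : ℝ) / n - H + (τ - (k : ℝ) / n) / 2, (H : ℝ) + (τ - (k : ℝ) / n) / 2)
    have hint : q ∈ interior ω.newtonPolygon := by
      refine mem_interior.mpr ⟨Set.Ioi ((k : ℝ) / n - H) ×ˢ Set.Ioi (H : ℝ), ?_,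
        isOpen_Ioi.prod isOpen_Ioi, ?_⟩
      · rintro z ⟨hz1, hz2⟩
        exact h.quadrant_subset hn (le_of_lt hz1) (le_of_lt hz2)
      · constructor
        · change (k : ℝ) / n - H < (k : ℝ) / n - H + (τ - (k : ℝ) / n) / 2
          linarith
        · change (H : ℝ) < (H : ℝ) + (τ - (k : ℝ) / n) / 2
          linarith
    have hqL : q ∈ coslopeLine 1 τ := by
      change (k : ℝ) / n - H + (τ - (k : ℝ) / n) / 2 + 1 * ((H : ℝ) + (τ - (k : ℝ) / n) / 2) = τ
      ring
    exact (hfr ⟨interior_subset hint, hqL⟩).2 hint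
  · rintro rfl
    refine ⟨⟨((k : ℝ) / n - H, (H : ℝ)), h.quadrant_subset hn le_rfl le_rfl, ?_⟩, ?_⟩
    · change (k : ℝ) / n - H + 1 * (H : ℝ) = (k : ℝ) / n
      ring
    · rintro p ⟨hp, hpL⟩
      have hpL' : p.1 + 1 * p.2 = (k : ℝ) / n := hpL
      refine ⟨subset_closure hp, fun hint => ?_⟩
      -- Any small shift to the left makes the coordinate sum smaller than its minimum `k/n` on the
      -- polygon.
      have hcont : Filter.Tendsto (fun ε : ℝ => (p.1 - ε, p.2)) (nhdsWithin 0 (Set.Ioi 0))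
          (nhds p) := by
        have : Continuous fun ε : ℝ => (p.1 - ε, p.2) := by fun_prop
        have h0 := this.tendsto 0
        simp only [sub_zero] at h0
        exact h0.mono_left nhdsWithin_le_nhds
      obtain ⟨ε, hε, hpos⟩ := ((hcont.eventually (mem_interior_iff_mem_nhds.mp hint)).and
        self_mem_nhdsWithin).exists
      have hpos' : (0 : ℝ) < ε := hpos
      rcases h.newtonPolygon_subset hn hε with h1 | ⟨h1, -⟩ <;> simp only at h1 <;> linarith

theorem isYOrder_iff (h : ω.IsInitialRow k H) (hn : 0 < n) {y : ℝ} :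
    ω.IsYOrder y ↔ y = H := by
  have hgreatest : IsGreatest (Prod.snd '' (ω.newtonPolygon ∩ coslopeLine 1 ((k : ℝ) / n))) H := by
    constructor
    · refine ⟨((k : ℝ) / n - H, (H : ℝ)), ⟨h.quadrant_subset hn le_rfl le_rfl, ?_⟩, rfl⟩
      change (k : ℝ) / n - H + 1 * (H : ℝ) = (k : ℝ) / n
      ring
    · rintro _ ⟨p, ⟨hp, hpL⟩, rfl⟩
      have hpL' : p.1 + 1 * p.2 = (k : ℝ) / n := hpL
      rcases h.newtonPolygon_subset hn hp with h1 | ⟨-, h1⟩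
      · linarith
      · exact h1
  constructor
  · rintro ⟨τ, hτ, hy⟩
    rw [(h.isSupportingLine_iff hn).mp hτ] at hy
    exact hy.unique hgreatest
  · rintro rfl
    exact ⟨_, (h.isSupportingLine_iff hn).mpr rfl, hgreatest⟩

end IsInitialRow

end FormalOneForm

end

theorem theorem1 (n : ℕ) (hn : 0 < n) (ω : FormalOneForm n)
    (hsing : ω.IsSingular) (hne : ω.a ≠ 0 ∨ ω.b ≠ 0) :
    (∃! h : ℝ, ω.IsYOrder h) ∧
    ∀ (m : ℕ) (_ : 0 < m) (f : PowerSeries ℂ), IsTransverse m f → ω.IsInvariant m f →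
      (puiseuxExponents n m f).Finite ∧
      (∀ h : ℝ, ω.IsYOrder h → ((puiseuxExponents n m f).ncard : ℝ) ≤ h) ∧
      ((puiseuxExponents n m f).ncard : ℝ≥0∞) ≤ ω.multiplicity := by
  obtain ⟨k, H, h⟩ := FormalOneForm.exists_isInitialRow hn hne
  refine ⟨⟨H, (h.isYOrder_iff hn).mpr rfl, fun y hy => (h.isYOrder_iff hn).mp hy⟩, ?_⟩
  intro m hm f hf hinv
  obtain ⟨hfin, hcard⟩ := h.finite_puiseuxExponents hn hm hf hinv
  refine ⟨hfin, fun y hy => ?_, ?_⟩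
  · rw [(h.isYOrder_iff hn).mp hy]
    exact_mod_cast hcard
  · exact le_trans (by exact_mod_cast hcard) (h.le_multiplicity hn)
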